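/- Let $N,L\ge 1$ be integers and let $P,\alpha_{\rm s},\sigma_{\rm s}^2,c,f_{\rm c},n_{\rm eff},d>0$. Put $\eta=\frac{c^2}{16\pi^2f_{\rm c}^2}$, $\lambda=c/f_{\rm c}$, $k_0=2\pi/\lambda$, $\lambda_{\rm g}=\lambda/n_{\rm eff}$, and for $\mathbf u\neq\boldsymbol\psi$ in $\mathbb R^3$ put $h(\mathbf u,\boldsymbol\psi)=\eta^{1/2}e^{-{\rm j}k_0\|\mathbf u-\boldsymbol\psi\|}/\|\mathbf u-\boldsymbol\psi\|$. Let the target be at $\mathbf u_{\rm s}=[x_{\rm s},y_{\rm s},0]^{\mathsf T}$, the $N$ transmit pinching antennas at $\boldsymbol\psi_n=[t_n,y_{\rm t},d]^{\mathsf T}$ with feed point $\boldsymbol\psi_0=[t_0,y_{\rm t},d]^{\mathsf T}$, and the receive pinching antenna at $\boldsymbol\varphi=[r,y_{\rm r},d]^{\mathsf T}$ with feed point $\boldsymbol\varphi_0=[r_0,y_{\rm r},d]^{\mathsf T}$. Define the deterministic quantities $$\mathbf h=\mathbf h(\mathbf u_{\rm s},\mathbf t)=[h(\mathbf u_{\rm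 s},\boldsymbol\psi_1),\dots,h(\mathbf u_{\rm s},\boldsymbol\psi_N)]^{\mathsf T},\qquad \boldsymbol\phi_{\rm t}=\big[e^{-{\rm j}2\pi\|\boldsymbol\psi_n-\boldsymbol\psi_0\|/\lambda_{\rm g}}\big]_{n=1}^N,\qquad g_{\rm r}=h(\mathbf u_{\rm s},\boldsymbol\varphi),\qquad \phi_{\rm r}=e^{-{\rm j}2\pi\|\boldsymbol\varphi-\boldsymbol\varphi_0\|/\lambda_{\rm g}}.$$ Let $\beta\sim\mathcal{CN}(0,\alpha_{\rm s})$ (the radar cross section), $\mathbf n_{\rm s}\in\mathbb C^{1\times L}$ with $\mathbf n_{\rm s}^{\mathsf T}\sim\mathcal{CN}(\mathbf 0,\sigma_{\rm s}^2\mathbf I_L)$ (the noise), and a random vector $\mathbf s\in\mathbb C^{1\times L}$ with $L^{-1}\|\mathbf s\|^2=1$ almost surely (the data stream) be mutually independent. Let $\mathbf x=\sqrt P\,\mathbf s$ be the transmitted signal, $\mathbf g=\beta g_{\rm r}\mathbf h$ the target response (a column vector), and $\mathbf y_{\rm s}=\sqrt{1/N}\,\mathbf g^{\mathsf T}\boldsymbol\phi_{\rm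 t}\,\mathbf x+\mathbf n_{\rm s}$ the echo. Then the sensing rate $\mathcal R_{\rm s}=L^{-1}I(\phi_{\rm r}\mathbf y_{\rm s};\mathbf g\mid\mathbf x)$, where $I(\cdot\,;\cdot\mid\cdot)$ is the conditional mutual information in bits, is $$\mathcal R_{\rm s}=L^{-1}\log_2(1+\gamma_{\rm s}),\qquad \gamma_{\rm s}=\frac{PL\alpha_{\rm s}}{N\sigma_{\rm s}^2}\,|g_{\rm r}|^2\,\big|\mathbf h^{\mathsf T}(\mathbf u_{\rm s},\mathbf t)\,\boldsymbol\phi_{\rm t}\big|^2 .$$ -/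

import Mathlib

open MeasureTheory ProbabilityTheory Matrix
open scoped ENNReal NNReal

noncomputable section

namespace PASS

/-! ### Information-theoretic notions -/

/-- Conditional mutual information `I(X; Y | Z)` in bits, as the relative entropy
`D(P_{Z,X,Y} ‖ P_Z ⊗ (P_{X|Z} × P_{Y|Z}))`, i.e. the average over `z ∼ P_Z` of
`D(P_{X,Y|Z=z} ‖ P_{X|Z=z} × P_{Y|Z=z})`. Mathlib's `klDiv` uses the natural logarithm, hence
the division by `log 2`. The value is in `[0, ∞]`. -/
def condMutualInfo {Ω A B C : Type*} [MeasurableSpace Ω]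
    [MeasurableSpace A] [StandardBorelSpace A] [Nonempty A]
    [MeasurableSpace B] [StandardBorelSpace B] [Nonempty B] [MeasurableSpace C]
    (μ : Measure Ω) [IsFiniteMeasure μ] (X : Ω → A) (Y : Ω → B) (Z : Ω → C) : ℝ≥0∞ :=
  InformationTheory.klDiv (μ.map (fun ω => (Z ω, (X ω, Y ω))))
      ((μ.map Z) ⊗ₘ ((condDistrib X Z μ) ×ₖ (condDistrib Y Z μ)))
    / ENNReal.ofReal (Real.log 2)

/-- The circularly symmetric complex Gaussian law `CN(0, v)` on `ℂ`: the real and imaginary parts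
are independent real Gaussians of mean `0` and variance `v / 2`. -/
def complexGaussian (v : ℝ≥0) : Measure ℂ :=
  ((gaussianReal 0 (v / 2)).prod (gaussianReal 0 (v / 2))).map (fun p => Complex.mk p.1 p.2)

/-- The circularly symmetric complex Gaussian law `CN(0, v I_L)` on `ℂ^L`: the entries are
independent with law `CN(0, v)`. -/
def complexGaussianVec (L : ℕ) (v : ℝ≥0) : Measure (Fin L → ℂ) :=
  Measure.pi (fun _ => complexGaussian v)

/-! ### The sensing model -/

/-- Physical and geometric parameters of a pinching-antenna sensing system with `N` transmit
pinching antennas. -/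
structure Params (N : ℕ) where
  /-- speed of light -/
  c : ℝ
  /-- carrier frequency -/
  fc : ℝ
  /-- effective refractive index of the waveguides -/
  neff : ℝ
  /-- height of the waveguides -/
  d : ℝ
  /-- `y`-coordinate of the transmit waveguide -/
  yt : ℝ
  /-- `y`-coordinate of the receive waveguide -/
  yr : ℝ
  /-- `x`-coordinate of the feed point of the transmit waveguide -/
  t0 : ℝ
  /-- `x`-coordinates of the transmit pinching antennas -/
  t : Fin N → ℝ
  /-- `x`-coordinate of the feed point of the receive waveguide -/
  r0 : ℝ
  /-- `x`-coordinate of the receive pinching antenna -/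
  r : ℝ
  /-- `x`-coordinate of the target -/
  xs : ℝ
  /-- `y`-coordinate of the target -/
  ys : ℝ
  c_pos : 0 < c
  fc_pos : 0 < fc
  neff_pos : 0 < neff
  d_pos : 0 < d

namespace Params

variable {N : ℕ} (S : Params N)

/-- `η = c² / (16 π² f_c²)`. -/
def eta : ℝ := S.c ^ 2 / (16 * Real.pi ^ 2 * S.fc ^ 2)

/-- Free-space wavelength `λ = c / f_c`. -/
def wavelength : ℝ := S.c / S.fc

/-- Wavenumber `k₀ = 2π / λ`. -/
def k0 : ℝ := 2 * Real.pi / S.wavelength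

/-- Guided wavelength `λ_g = λ / n_eff`. -/
def guidedWavelength : ℝ := S.wavelength / S.neff

/-- Location `u_s` of the target. -/
def us : EuclideanSpace ℝ (Fin 3) := !₂[S.xs, S.ys, 0]

/-- Location `ψ_n` of the `n`-th transmit pinching antenna. -/
def psi (n : Fin N) : EuclideanSpace ℝ (Fin 3) := !₂[S.t n, S.yt, S.d]

/-- Location `ψ_0` of the feed point of the transmit waveguide. -/
def psi0 : EuclideanSpace ℝ (Fin 3) := !₂[S.t0, S.yt, S.d]

/-- Location of the receive pinching antenna. -/
def varphi : EuclideanSpace ℝ (Fin 3) := !₂[S.r, S.yr, S.d]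

/-- Location of the feed point of the receive waveguide. -/
def varphi0 : EuclideanSpace ℝ (Fin 3) := !₂[S.r0, S.yr, S.d]

/-- Free-space line-of-sight channel coefficient
`h(u, ψ) = η^{1/2} e^{-j k₀ ‖u - ψ‖} / ‖u - ψ‖`. -/
def h (u ψ : EuclideanSpace ℝ (Fin 3)) : ℂ :=
  (Real.sqrt S.eta : ℂ) * Complex.exp (-Complex.I * ((S.k0 * ‖u - ψ‖ : ℝ) : ℂ)) / (‖u - ψ‖ : ℂ)

/-- Transmit beam-steering vector `h(u_s, t)`. -/
def hVec : Fin N → ℂ := fun n => S.h S.us (S.psi n)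

/-- In-waveguide phase vector `φ_t = [e^{-j φ_1}, …, e^{-j φ_N}]ᵀ` with
`φ_n = 2π ‖ψ_n - ψ_0‖ / λ_g`. -/
def phiT : Fin N → ℂ := fun n =>
  Complex.exp (-Complex.I * ((2 * Real.pi * ‖S.psi n - S.psi0‖ / S.guidedWavelength : ℝ) : ℂ))

/-- Channel coefficient `g_r` from the target to the receive pinching antenna. -/
def gr : ℂ := S.h S.us S.varphi

/-- In-waveguide phase factor `φ_r` of the receive waveguide. -/
def phiR : ℂ :=
  Complex.exp (-Complex.I * ((2 * Real.pi * ‖S.varphi - S.varphi0‖ / S.guidedWavelength : ℝ) : ℂ))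

/-- Transmitted signal `x = √P s`. -/
def txSignal {L : ℕ} (P : ℝ) (s : Fin L → ℂ) : Fin L → ℂ := (Real.sqrt P : ℂ) • s

/-- Target response vector `g = β g_r hᵀ(u_s, t)` for the radar cross section `β`. -/
def targetResponse (β : ℂ) : Fin N → ℂ := (β * S.gr) • S.hVec

/-- Reflected echo `y_s = √(1/N) gᵀ φ_t x + n_s`, for target response `g`, transmitted
signal `x` and noise `n_s`. -/
def echo {L : ℕ} (g : Fin N → ℂ) (x n : Fin L → ℂ) : Fin L → ℂ :=
  ((Real.sqrt (1 / (N : ℝ)) : ℂ) * (g ⬝ᵥ S.phiT)) • x + n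

/-- Sensing rate `R_s = L⁻¹ I(φ_r y_s ; g | x)` (bits per symbol), where the radar cross section
`β`, the data stream `s` and the noise `n` are random variables on `(Ω, μ)`. -/
def sensingRate {Ω : Type*} [MeasurableSpace Ω] (μ : Measure Ω) [IsFiniteMeasure μ] {L : ℕ}
    (P : ℝ) (β : Ω → ℂ) (s n : Ω → Fin L → ℂ) : ℝ≥0∞ :=
  (L : ℝ≥0∞)⁻¹ *
    condMutualInfo μ
      (fun ω => S.phiR • S.echo (S.targetResponse (β ω)) (txSignal P (s ω)) (n ω))
      (fun ω => S.targetResponse (β ω))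
      (fun ω => txSignal P (s ω))

/-- Effective sensing SNR `γ_s = (P L α_s / (N σ_s²)) |g_r|² |hᵀ(u_s, t) φ_t|²`, where `σ2` is
the noise power `σ_s²`. -/
def gammaS (L : ℕ) (P αs σ2 : ℝ) : ℝ :=
  P * L * αs / (N * σ2) * ‖S.gr‖ ^ 2 * ‖S.hVec ⬝ᵥ S.phiT‖ ^ 2

end Params

end PASS

end

namespace PASS

/-! ### Densities of product measures and of images -/

/-! Since `φ_r` has modulus one and the noise law is rotation invariant, the received signal is `X =
a β Z + W`, where `Z = x`, `W = φ_r n_s` has the law of `n_s`, and `a = φ_r √(1/N) g_r (hᵀ φ_t)`.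
The response `g` is a function of `β` from which `a β` can be read off, so the model is a scalar
Gaussian channel with known signal `Z` of energy `T = P L`.

The law of `g` is carried by a line in `ℂ^N`, so Lebesgue densities are avoided. Everything is
compared with the reference measure `P_Z × P_W × P_g`. Against it the joint law of `(Z, X, g)` has
density `exp F`, with `F` the Gaussian log-likelihood ratio of a shift
(`complexGaussianVec_map_add`, `map_additive_channel`). The conditionally independent law has the
average of `exp F` over `g` as density (`compProd_condDistrib_prod_eq_withDensity`), which is `exp
G` by completing a square (`lintegral_exp_complexGaussian`). Hence the divergence is `E[F - G]`
(`condMutualInfo_of_density`).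

By `gaussian_llr_eq`, `F - G` is `log (1 + γ)` plus multiples of `|β|²`, of a cross term and of `|Z*
W|²`, where `γ = |a|² T α / v`. The cross term has mean zero and the two quadratic terms cancel in
expectation, leaving `log (1 + γ)`. -/

theorem map_withDensity_comp {α β : Type*} [MeasurableSpace α] [MeasurableSpace β]
    {μ : Measure α} {ν : Measure β} {g : α → β} (hg : MeasurePreserving g μ ν)
    {f : β → ℝ≥0∞} (hf : Measurable f) :
    (μ.withDensity fun x => f (g x)).map g = ν.withDensity f := by
  ext s hs
  rw [Measure.map_apply hg.measurable hs, withDensity_apply _ (hg.measurable hs),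
    withDensity_apply _ hs, ← hg.map_eq, setLIntegral_map hs hf hg.measurable]

theorem lintegral_pi_prod {ι : Type*} [Fintype ι] {E : ι → Type*} [∀ i, MeasurableSpace (E i)]
    (μ : ∀ i, Measure (E i)) [∀ i, IsProbabilityMeasure (μ i)] {f : ∀ i, E i → ℝ≥0∞}
    (hf : ∀ i, Measurable (f i)) :
    ∫⁻ x, ∏ i, f i (x i) ∂Measure.pi μ = ∏ i, ∫⁻ y, f i y ∂μ i := by
  have h := iIndepFun_pi (μ := μ) (X := f) (fun i => (hf i).aemeasurable)
  rw [lintegral_prod_eq_prod_lintegral_of_indepFun Finset.univ _ h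
    (fun i => (hf i).comp (measurable_pi_apply i))]
  refine Finset.prod_congr rfl fun i _ => ?_
  exact (measurePreserving_eval μ i).lintegral_comp (hf i)

/-- It suffices to test on boxes: there the indicator times the product density splits into one
factor per coordinate. -/
theorem pi_withDensity {ι : Type*} [Fintype ι] {E : ι → Type*} [∀ i, MeasurableSpace (E i)]
    (μ : ∀ i, Measure (E i)) [∀ i, IsProbabilityMeasure (μ i)] {f : ∀ i, E i → ℝ≥0∞}
    (hf : ∀ i, Measurable (f i)) [∀ i, SigmaFinite ((μ i).withDensity (f i))] :
    Measure.pi (fun i => (μ i).withDensity (f i))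
      = (Measure.pi μ).withDensity fun x => ∏ i, f i (x i) := by
  classical
  refine Measure.pi_eq fun s hs => ?_
  rw [withDensity_apply _ (MeasurableSet.univ_pi hs),
    ← lintegral_indicator (MeasurableSet.univ_pi hs)]
  have : (Set.univ.pi s).indicator (fun x => ∏ i, f i (x i))
      = fun x => ∏ i, (s i).indicator (f i) (x i) := by
    funext x
    by_cases hx : x ∈ Set.univ.pi s
    · rw [Set.indicator_of_mem hx]
      exact Finset.prod_congr rfl fun i _ =>
        (Set.indicator_of_mem (hx i (Set.mem_univ i)) _).symm
    · rw [Set.indicator_of_notMem hx]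
      simp only [Set.mem_pi, Set.mem_univ, true_implies, not_forall] at hx
      obtain ⟨i, hi⟩ := hx
      exact (Finset.prod_eq_zero (Finset.mem_univ i) (Set.indicator_of_notMem hi _)).symm
  rw [this, lintegral_pi_prod μ fun i => (hf i).indicator (hs i)]
  exact Finset.prod_congr rfl fun i _ => by
    rw [lintegral_indicator (hs i), withDensity_apply _ (hs i)]

/-! ### The circularly symmetric complex Gaussian law -/

theorem measurable_complex_mk : Measurable fun p : ℝ × ℝ => Complex.mk p.1 p.2 :=
  Complex.measurableEquivRealProd.symm.measurable

instance (v : ℝ≥0) : IsProbabilityMeasure (complexGaussian v) :=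
  Measure.isProbabilityMeasure_map measurable_complex_mk.aemeasurable

instance (L : ℕ) (v : ℝ≥0) : IsProbabilityMeasure (complexGaussianVec L v) := by
  unfold complexGaussianVec; infer_instance

/-- Density of `CN(0, v)`. -/
noncomputable def complexGaussianPDF (v : ℝ) (z : ℂ) : ℝ := (Real.pi * v)⁻¹ * Real.exp (-‖z‖ ^ 2 / v)

theorem complexGaussianPDF_nonneg {v : ℝ} (hv : 0 ≤ v) (z : ℂ) : 0 ≤ complexGaussianPDF v z := by
  unfold complexGaussianPDF; positivity

theorem measurable_complexGaussianPDF (v : ℝ) : Measurable (complexGaussianPDF v) := by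
  unfold complexGaussianPDF; fun_prop

theorem complexGaussian_eq_withDensity {v : ℝ≥0} (hv : v ≠ 0) :
    complexGaussian v = volume.withDensity fun z => ENNReal.ofReal (complexGaussianPDF v z) := by
  have hv2 : v / 2 ≠ 0 := by positivity
  have hvpos : 0 < (v : ℝ) := by positivity
  unfold complexGaussian
  rw [gaussianReal_of_var_ne_zero 0 hv2, prod_withDensity (measurable_gaussianPDF _ _)
    (measurable_gaussianPDF _ _),
    ← map_withDensity_comp (Complex.volume_preserving_equiv_real_prod.symm)
      (measurable_complexGaussianPDF v).ennreal_ofReal]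
  congr 1
  rw [← Measure.volume_eq_prod]
  congr 1
  funext p
  rw [gaussianPDF, gaussianPDF, ← ENNReal.ofReal_mul (gaussianPDFReal_nonneg _ _ _)]
  congr 1
  simp only [gaussianPDFReal, complexGaussianPDF, sub_zero, NNReal.coe_div, NNReal.coe_ofNat]
  have hs : √(2 * Real.pi * (v / 2)) * √(2 * Real.pi * (v / 2)) = Real.pi * v := by
    rw [Real.mul_self_sqrt (by positivity)]; ring
  rw [← hs, mul_inv, mul_mul_mul_comm, ← Real.exp_add]
  congr 2
  rw [← Complex.normSq_eq_norm_sq, Complex.normSq_apply]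
  simp only [Complex.measurableEquivRealProd_symm_apply]
  field_simp
  ring

/-- The density depends only on `‖z‖`, and rotations preserve Lebesgue measure. -/
theorem complexGaussian_map_mul {v : ℝ≥0} (hv : v ≠ 0) {a : ℂ} (ha : ‖a‖ = 1) :
    (complexGaussian v).map (fun z => a * z) = complexGaussian v := by
  have hmp : MeasurePreserving (fun z : ℂ => a * z) volume volume :=
    (rotation ⟨a, mem_sphere_zero_iff_norm.2 ha⟩).measurePreserving
  rw [complexGaussian_eq_withDensity hv]
  conv_rhs => rw [← map_withDensity_comp hmp (measurable_complexGaussianPDF v).ennreal_ofReal]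
  simp [complexGaussianPDF, ha]

theorem complexGaussianVec_map_smul {L : ℕ} {v : ℝ≥0} (hv : v ≠ 0) {a : ℂ} (ha : ‖a‖ = 1) :
    (complexGaussianVec L v).map (fun z => a • z) = complexGaussianVec L v := by
  unfold complexGaussianVec
  have := Measure.pi_map_pi (μ := fun _ : Fin L => complexGaussian v)
    (f := fun _ z => a * z) (fun _ => by fun_prop)
    (hμ := fun _ => by rw [complexGaussian_map_mul hv ha]; infer_instance)
  rw [complexGaussian_map_mul hv ha] at this
  exact this

/-- Likelihood ratio of `CN(u, v)` with respect to `CN(0, v)`. -/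
theorem complexGaussian_map_add {v : ℝ≥0} (hv : v ≠ 0) (u : ℂ) :
    (complexGaussian v).map (fun z => u + z) = (complexGaussian v).withDensity
      fun x => ENNReal.ofReal (Real.exp ((2 * (star u * x).re - ‖u‖ ^ 2) / v)) := by
  have hmp : MeasurePreserving (fun z : ℂ => u + z) volume volume :=
    measurePreserving_add_left volume u
  have hf : Measurable fun z : ℂ => ENNReal.ofReal (complexGaussianPDF v (z - u)) :=
    ((measurable_complexGaussianPDF v).comp (measurable_id.sub_const u)).ennreal_ofReal
  rw [complexGaussian_eq_withDensity hv, ← withDensity_mul _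
    (measurable_complexGaussianPDF v).ennreal_ofReal (by fun_prop)]
  have h := map_withDensity_comp hmp hf
  simp only [add_sub_cancel_left] at h
  rw [h]
  congr 1
  funext x
  have h0 : 0 ≤ complexGaussianPDF v x := complexGaussianPDF_nonneg v.2 x
  rw [Pi.mul_apply, ← ENNReal.ofReal_mul h0]
  congr 1
  rw [complexGaussianPDF, complexGaussianPDF, mul_assoc, ← Real.exp_add]
  congr 2
  simp only [← Complex.normSq_eq_norm_sq, Complex.normSq_apply, Complex.sub_re, Complex.sub_im,
    Complex.mul_re, Complex.star_def, Complex.conj_re, Complex.conj_im]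
  ring

/-- Coordinates are independent, so the scalar likelihood ratios multiply and their exponents add.
-/
theorem complexGaussianVec_map_add {L : ℕ} {v : ℝ≥0} (hv : v ≠ 0) (u : Fin L → ℂ) :
    (complexGaussianVec L v).map (fun z => u + z) = (complexGaussianVec L v).withDensity
      fun x => ENNReal.ofReal (Real.exp ((2 * (star u ⬝ᵥ x).re - ∑ l, ‖u l‖ ^ 2) / v)) := by
  have hprob : ∀ l, IsProbabilityMeasure ((complexGaussian v).map (fun z => u l + z)) := fun l =>
    Measure.isProbabilityMeasure_map (by fun_prop)
  have hsig : ∀ l, SigmaFinite ((complexGaussian v).withDensity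
      fun x => ENNReal.ofReal (Real.exp ((2 * (star (u l) * x).re - ‖u l‖ ^ 2) / v))) := fun l => by
    rw [← complexGaussian_map_add hv]; infer_instance
  unfold complexGaussianVec
  have h1 := Measure.pi_map_pi (μ := fun _ : Fin L => complexGaussian v)
    (f := fun l z => u l + z) (fun _ => by fun_prop)
  have h2 := pi_withDensity (fun _ : Fin L => complexGaussian v)
    (f := fun l x => ENNReal.ofReal (Real.exp ((2 * (star (u l) * x).re - ‖u l‖ ^ 2) / v)))
    (fun l => by fun_prop)
  simp only [complexGaussian_map_add hv] at h1
  refine (h1.trans h2).trans ?_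
  congr 1
  funext x
  rw [← ENNReal.ofReal_prod_of_nonneg fun _ _ => (Real.exp_pos _).le, ← Real.exp_sum,
    ← Finset.sum_div, Finset.sum_sub_distrib, ← Finset.mul_sum, ← Complex.re_sum]
  rfl

/-- Gaussian integral of the exponential of a real quadratic polynomial. -/
theorem lintegral_exp_complexGaussian {v : ℝ≥0} (hv : v ≠ 0) {q : ℝ} (hq : 0 ≤ q) (ζ : ℂ) :
    ∫⁻ b, ENNReal.ofReal (Real.exp (2 * (star b * ζ).re - q * ‖b‖ ^ 2)) ∂complexGaussian v
      = ENNReal.ofReal ((1 + q * v)⁻¹ * Real.exp (v * ‖ζ‖ ^ 2 / (1 + q * v))) := by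
  have hvpos : 0 < (v : ℝ) := by positivity
  have hpos : 0 < 1 + q * v := by positivity
  -- Completing the square turns the integrand times the `CN(0, v)` density into a constant times
  -- the density of `CN(w ζ, w)`; `w` is the posterior variance of the input.
  obtain ⟨w, hw⟩ : ∃ w : ℝ≥0, (w : ℝ) = v / (1 + q * v) :=
    ⟨⟨v / (1 + q * v), by positivity⟩, rfl⟩
  have hw0 : w ≠ 0 := by
    have : (0 : ℝ) < w := by rw [hw]; positivity
    exact_mod_cast this.ne'
  rw [complexGaussian_eq_withDensity hv, lintegral_withDensity_eq_lintegral_mul _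
    (measurable_complexGaussianPDF v).ennreal_ofReal (by fun_prop)]
  have hpt : ∀ b : ℂ, complexGaussianPDF v b * Real.exp (2 * (star b * ζ).re - q * ‖b‖ ^ 2)
      = ((1 + q * v)⁻¹ * Real.exp (v * ‖ζ‖ ^ 2 / (1 + q * v)))
        * complexGaussianPDF w (b - (w : ℝ) • ζ) := by
    intro b
    rw [complexGaussianPDF, complexGaussianPDF, mul_assoc, ← Real.exp_add, mul_mul_mul_comm,
      ← Real.exp_add]
    congr 1
    · rw [hw]; field_simp
    · congr 1
      simp only [← Complex.normSq_eq_norm_sq, Complex.normSq_apply, Complex.sub_re, Complex.sub_im,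
        Complex.mul_re, Complex.star_def, Complex.conj_re, Complex.conj_im, Complex.real_smul,
        Complex.mul_im, Complex.ofReal_re, Complex.ofReal_im, hw]
      field_simp
      ring
  have hC : 0 ≤ (1 + q * v)⁻¹ * Real.exp (v * ‖ζ‖ ^ 2 / (1 + q * v)) := by positivity
  simp only [Pi.mul_apply]
  simp_rw [← ENNReal.ofReal_mul (complexGaussianPDF_nonneg hvpos.le _), hpt,
    ENNReal.ofReal_mul hC]
  have hm : Measurable fun b : ℂ =>
      ENNReal.ofReal (complexGaussianPDF w (b - (w : ℝ) • ζ)) :=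
    ((measurable_complexGaussianPDF w).comp (measurable_id.sub_const _)).ennreal_ofReal
  rw [lintegral_const_mul _ hm,
    lintegral_sub_right_eq_self (fun b => ENNReal.ofReal (complexGaussianPDF w b))]
  have h1 : complexGaussian w Set.univ = 1 := measure_univ
  rw [complexGaussian_eq_withDensity hw0, withDensity_apply _ MeasurableSet.univ,
    Measure.restrict_univ] at h1
  rw [h1, mul_one]

theorem memLp_gaussianReal_two (v : ℝ≥0) : MemLp (fun x : ℝ => x) 2 (gaussianReal 0 v) :=
  memLp_id_gaussianReal 2

theorem integral_sq_gaussianReal (v : ℝ≥0) : ∫ x, x ^ 2 ∂gaussianReal 0 v = v := by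
  have h := variance_eq_sub (memLp_gaussianReal_two v)
  rw [variance_fun_id_gaussianReal] at h
  simp only [integral_id_gaussianReal] at h
  simp only [Pi.pow_apply] at h
  linarith

theorem memLp_complexGaussian (v : ℝ≥0) : MemLp (fun z : ℂ => z) 2 (complexGaussian v) := by
  unfold complexGaussian
  rw [memLp_map_measure_iff (by fun_prop) measurable_complex_mk.aemeasurable]
  have h1 : MemLp (fun p : ℝ × ℝ => (p.1 : ℂ)) 2
      ((gaussianReal 0 (v / 2)).prod (gaussianReal 0 (v / 2))) :=
    ((memLp_gaussianReal_two _).ofReal (K := ℂ)).comp_fst _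
  have h2 : MemLp (fun p : ℝ × ℝ => (p.2 : ℂ)) 2
      ((gaussianReal 0 (v / 2)).prod (gaussianReal 0 (v / 2))) :=
    ((memLp_gaussianReal_two _).ofReal (K := ℂ)).comp_snd _
  refine (h1.add (h2.mul_const Complex.I)).congr_norm ?_ ?_
  · exact measurable_complex_mk.aestronglyMeasurable
  · exact Filter.Eventually.of_forall fun p => by
      simp [Complex.mk_eq_add_mul_I]

theorem integral_complexGaussian (v : ℝ≥0) : ∫ z, z ∂complexGaussian v = 0 := by
  unfold complexGaussian
  rw [integral_map measurable_complex_mk.aemeasurable (by fun_prop)]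
  simp only [Complex.mk_eq_add_mul_I]
  have hi : Integrable (fun x : ℝ => (x : ℂ)) (gaussianReal 0 (v / 2)) :=
    ((memLp_gaussianReal_two _).integrable one_le_two).ofReal
  rw [integral_add (hi.comp_fst _) ((hi.comp_snd _).mul_const _), integral_mul_const,
    integral_fun_fst, integral_fun_snd, integral_complex_ofReal]
  simp [integral_id_gaussianReal]

theorem integral_norm_sq_complexGaussian (v : ℝ≥0) : ∫ z, ‖z‖ ^ 2 ∂complexGaussian v = v := by
  unfold complexGaussian
  rw [integral_map measurable_complex_mk.aemeasurable (by fun_prop)]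
  have hi : Integrable (fun x : ℝ => x ^ 2) (gaussianReal 0 (v / 2)) :=
    (memLp_gaussianReal_two _).integrable_sq
  have : ∀ p : ℝ × ℝ, ‖Complex.mk p.1 p.2‖ ^ 2 = p.1 ^ 2 + p.2 ^ 2 := fun p => by
    rw [← Complex.normSq_eq_norm_sq, Complex.normSq_apply]; ring
  simp only [this]
  rw [integral_add (hi.comp_fst _) (hi.comp_snd _), integral_fun_fst (fun x : ℝ => x ^ 2),
    integral_fun_snd (fun x : ℝ => x ^ 2), integral_sq_gaussianReal]
  simp

/-! ### Conditional mutual information of channels with a density -/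

/-- The log-likelihood ratio is `F` almost everywhere, and the mass correction in `klDiv` vanishes
for probability measures. -/
theorem klDiv_of_eq_withDensity_exp {α : Type*} [MeasurableSpace α] {μ ν : Measure α}
    [IsProbabilityMeasure μ] [IsProbabilityMeasure ν] {F : α → ℝ} (hF : Measurable F)
    (h : μ = ν.withDensity fun x => ENNReal.ofReal (Real.exp (F x))) (hint : Integrable F μ) :
    InformationTheory.klDiv μ ν = ENNReal.ofReal (∫ x, F x ∂μ) := by
  have hac : μ ≪ ν := h ▸ withDensity_absolutelyContinuous _ _
  have hrn : μ.rnDeriv ν =ᵐ[ν] fun x => ENNReal.ofReal (Real.exp (F x)) := by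
    conv_lhs => rw [h]
    exact Measure.rnDeriv_withDensity ν (by fun_prop)
  have hllr : llr μ ν =ᵐ[μ] F := by
    filter_upwards [hac.ae_le hrn] with x hx
    rw [llr, hx, ENNReal.toReal_ofReal (Real.exp_pos _).le, Real.log_exp]
  rw [InformationTheory.klDiv_of_ac_of_integrable hac ((integrable_congr hllr).2 hint),
    integral_congr_ae hllr]
  simp

section Channel

variable {Ω A B C : Type*} [MeasurableSpace Ω] [MeasurableSpace A] [MeasurableSpace B]
  [MeasurableSpace C]

/-- Independence makes the conditional law of `Y` constant, and integrating `ℓ` over `y` gives the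
density of `(Z, X)`. Against a test function `f`, for fixed `z` and `x`, both sides are the product
of the `y`-integrals of `ℓ` and `f`. -/
theorem compProd_condDistrib_prod_eq_withDensity
    [StandardBorelSpace A] [Nonempty A] [StandardBorelSpace B] [Nonempty B]
    {μ : Measure Ω} [IsProbabilityMeasure μ] {X : Ω → A} {Y : Ω → B} {Z : Ω → C}
    (hX : Measurable X) (hY : Measurable Y) (hZ : Measurable Z) {ν : Measure A}
    [IsProbabilityMeasure ν] {ℓ : C × A × B → ℝ≥0∞} (hℓ : Measurable ℓ)
    (hjoint : μ.map (fun ω => (Z ω, X ω, Y ω))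
      = ((μ.map Z).prod (ν.prod (μ.map Y))).withDensity ℓ)
    (hYZ : IndepFun Z Y μ) :
    (μ.map Z) ⊗ₘ ((condDistrib X Z μ) ×ₖ (condDistrib Y Z μ))
      = ((μ.map Z).prod (ν.prod (μ.map Y))).withDensity
          fun p => ∫⁻ y, ℓ (p.1, p.2.1, y) ∂(μ.map Y) := by
  have : IsProbabilityMeasure (μ.map Y) := Measure.isProbabilityMeasure_map hY.aemeasurable
  have : IsProbabilityMeasure (μ.map Z) := Measure.isProbabilityMeasure_map hZ.aemeasurable
  have hcY : condDistrib Y Z μ =ᵐ[μ.map Z] Kernel.const C (μ.map Y) := by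
    refine condDistrib_ae_eq_of_measure_eq_compProd Z hY.aemeasurable ?_
    rw [Measure.compProd_const]
    exact (indepFun_iff_map_prod_eq_prod_map_map hZ.aemeasurable hY.aemeasurable).1 hYZ
  have hcongr : (condDistrib X Z μ) ×ₖ (condDistrib Y Z μ)
      =ᵐ[μ.map Z] (condDistrib X Z μ) ×ₖ (Kernel.const C (μ.map Y)) := by
    filter_upwards [hcY] with z hz
    rw [Kernel.prod_apply, Kernel.prod_apply, hz]
  rw [Measure.compProd_congr hcongr]
  refine Measure.ext_of_lintegral _ fun f hf => ?_
  have hinner : Measurable fun p : C × A => ∫⁻ y, f (p.1, p.2, y) ∂(μ.map Y) :=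
    Measurable.lintegral_prod_right' (f := fun q : (C × A) × B => f (q.1.1, q.1.2, q.2))
      (by fun_prop)
  have hdens : Measurable fun p : C × A => ∫⁻ y, ℓ (p.1, p.2, y) ∂(μ.map Y) :=
    Measurable.lintegral_prod_right' (f := fun q : (C × A) × B => ℓ (q.1.1, q.1.2, q.2))
      (by fun_prop)
  have hdens' : Measurable fun p : C × A × B => ∫⁻ y, ℓ (p.1, p.2.1, y) ∂(μ.map Y) :=
    hdens.comp (g := fun p : C × A => ∫⁻ y, ℓ (p.1, p.2, y) ∂(μ.map Y))
      (f := fun p : C × A × B => (p.1, p.2.1)) (by fun_prop)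
  have hmap : μ.map (fun ω => (Z ω, X ω))
      = (μ.map (fun ω => (Z ω, X ω, Y ω))).map fun p => (p.1, p.2.1) := by
    rw [Measure.map_map (by fun_prop) (by fun_prop)]; rfl
  have hl : ∫⁻ p, f p ∂((μ.map Z) ⊗ₘ ((condDistrib X Z μ) ×ₖ (Kernel.const C (μ.map Y))))
      = ∫⁻ p, (∫⁻ y, f (p.1, p.2, y) ∂(μ.map Y)) ∂(μ.map fun ω => (Z ω, X ω)) := by
    rw [← compProd_map_condDistrib hX.aemeasurable, Measure.lintegral_compProd hf,
      Measure.lintegral_compProd hinner]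
    refine lintegral_congr fun z => ?_
    rw [Kernel.lintegral_prod _ _ _ (by fun_prop)]
    simp
  have hinner' : Measurable fun p : C × A × B => ∫⁻ y, f (p.1, p.2.1, y) ∂(μ.map Y) :=
    hinner.comp (f := fun p : C × A × B => (p.1, p.2.1)) (by fun_prop)
  rw [hl, hmap, lintegral_map hinner (by fun_prop), hjoint,
    lintegral_withDensity_eq_lintegral_mul _ hℓ hinner',
    lintegral_withDensity_eq_lintegral_mul _ hdens' hf]
  have hm1 : Measurable (ℓ * fun p : C × A × B => ∫⁻ y, f (p.1, p.2.1, y) ∂(μ.map Y)) :=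
    hℓ.mul hinner'
  have hm2 : Measurable ((fun p : C × A × B => ∫⁻ y, ℓ (p.1, p.2.1, y) ∂(μ.map Y)) * f) :=
    hdens'.mul hf
  rw [lintegral_prod _ hm1.aemeasurable, lintegral_prod _ hm2.aemeasurable]
  refine lintegral_congr fun z => ?_
  have hm1z : Measurable fun r : A × B =>
      (ℓ * fun p : C × A × B => ∫⁻ y, f (p.1, p.2.1, y) ∂(μ.map Y)) (z, r) :=
    hm1.comp measurable_prodMk_left
  have hm2z : Measurable fun r : A × B =>
      ((fun p : C × A × B => ∫⁻ y, ℓ (p.1, p.2.1, y) ∂(μ.map Y)) * f) (z, r) :=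
    hm2.comp measurable_prodMk_left
  rw [lintegral_prod _ hm1z.aemeasurable, lintegral_prod _ hm2z.aemeasurable]
  refine lintegral_congr fun x => ?_
  simp only [Pi.mul_apply]
  rw [lintegral_mul_const _ (by fun_prop), lintegral_const_mul _ (by fun_prop)]

/-- The joint law and the conditionally independent law have densities `exp F` and `exp G` against
one reference measure, so their log-likelihood ratio is `F - G`. -/
theorem condMutualInfo_of_density
    [StandardBorelSpace A] [Nonempty A] [StandardBorelSpace B] [Nonempty B]
    {μ : Measure Ω} [IsProbabilityMeasure μ] {X : Ω → A} {Y : Ω → B} {Z : Ω → C}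
    (hX : Measurable X) (hY : Measurable Y) (hZ : Measurable Z) {ν : Measure A}
    [IsProbabilityMeasure ν] {F : C × A × B → ℝ} (hF : Measurable F)
    (hjoint : μ.map (fun ω => (Z ω, X ω, Y ω))
      = ((μ.map Z).prod (ν.prod (μ.map Y))).withDensity
          fun p => ENNReal.ofReal (Real.exp (F p)))
    (hYZ : IndepFun Z Y μ) {G : C × A → ℝ} (hG : Measurable G)
    (hFG : ∀ z x, ∫⁻ y, ENNReal.ofReal (Real.exp (F (z, x, y))) ∂(μ.map Y)
      = ENNReal.ofReal (Real.exp (G (z, x))))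
    (hint : Integrable (fun ω => F (Z ω, X ω, Y ω) - G (Z ω, X ω)) μ) :
    condMutualInfo μ X Y Z
      = ENNReal.ofReal (∫ ω, (F (Z ω, X ω, Y ω) - G (Z ω, X ω)) ∂μ)
        / ENNReal.ofReal (Real.log 2) := by
  have : IsProbabilityMeasure (μ.map Y) := Measure.isProbabilityMeasure_map hY.aemeasurable
  have : IsProbabilityMeasure (μ.map Z) := Measure.isProbabilityMeasure_map hZ.aemeasurable
  have hT : Measurable fun ω => (Z ω, X ω, Y ω) := by fun_prop
  have : IsProbabilityMeasure (μ.map fun ω => (Z ω, X ω, Y ω)) :=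
    Measure.isProbabilityMeasure_map hT.aemeasurable
  have hD : Measurable fun p : C × A × B => F p - G (p.1, p.2.1) := by fun_prop
  have hprod := compProd_condDistrib_prod_eq_withDensity hX hY hZ (by fun_prop) hjoint hYZ
  simp only [hFG] at hprod
  unfold condMutualInfo
  rw [klDiv_of_eq_withDensity_exp hD _ ((integrable_map_measure hD.aestronglyMeasurable
    hT.aemeasurable).2 hint), integral_map hT.aemeasurable hD.aestronglyMeasurable]
  rw [hprod, ← withDensity_mul _ (by fun_prop) (by fun_prop), hjoint]
  congr 1
  funext p
  rw [Pi.mul_apply, ← ENNReal.ofReal_mul (Real.exp_pos _).le, ← Real.exp_add]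
  congr 2
  ring

/-- Joint law of input and output of an additive channel whose shifted noise laws have density
`ℓ` with respect to the noise law. -/
theorem map_additive_channel {E : Type*} [MeasurableSpace E] [Add E] [MeasurableAdd₂ E]
    {μ : Measure Ω} [IsProbabilityMeasure μ] {Y : Ω → B} {Z : Ω → C} {W : Ω → E}
    (hY : Measurable Y) (hZ : Measurable Z) (hW : Measurable W)
    (hlaw : μ.map (fun ω => (Z ω, Y ω, W ω))
      = (μ.map Z).prod ((μ.map Y).prod (μ.map W)))
    {u : C → B → E} (hu : Measurable fun p : C × B => u p.1 p.2)
    {ℓ : E → E → ℝ≥0∞} (hℓ : Measurable fun p : E × E => ℓ p.1 p.2)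
    (hshift : ∀ v, (μ.map W).map (fun x => v + x) = (μ.map W).withDensity (ℓ v)) :
    μ.map (fun ω => (Z ω, u (Z ω) (Y ω) + W ω, Y ω))
      = ((μ.map Z).prod ((μ.map W).prod (μ.map Y))).withDensity
          fun p => ℓ (u p.1 p.2.2) p.2.1 := by
  have : IsProbabilityMeasure (μ.map Y) := Measure.isProbabilityMeasure_map hY.aemeasurable
  have : IsProbabilityMeasure (μ.map Z) := Measure.isProbabilityMeasure_map hZ.aemeasurable
  have : IsProbabilityMeasure (μ.map W) := Measure.isProbabilityMeasure_map hW.aemeasurable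
  have hT : Measurable fun p : C × B × E => (p.1, u p.1 p.2.1 + p.2.2, p.2.1) :=
    measurable_fst.prodMk (((hu.comp (measurable_fst.prodMk measurable_snd.fst)).add
      measurable_snd.snd).prodMk measurable_snd.fst)
  have hmap : μ.map (fun ω => (Z ω, u (Z ω) (Y ω) + W ω, Y ω))
      = (μ.map (fun ω => (Z ω, Y ω, W ω))).map
          fun p => (p.1, u p.1 p.2.1 + p.2.2, p.2.1) := by
    rw [Measure.map_map hT (by fun_prop)]; rfl
  have hd : Measurable fun p : C × E × B => ℓ (u p.1 p.2.2) p.2.1 :=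
    hℓ.comp ((hu.comp (measurable_fst.prodMk measurable_snd.snd)).prodMk measurable_snd.fst)
  refine Measure.ext_of_lintegral _ fun f hf => ?_
  have hfd : Measurable ((fun p : C × E × B => ℓ (u p.1 p.2.2) p.2.1) * f) := hd.mul hf
  have hfT : Measurable fun p : C × B × E => f (p.1, u p.1 p.2.1 + p.2.2, p.2.1) := hf.comp hT
  rw [hmap, lintegral_map hf hT, hlaw, lintegral_withDensity_eq_lintegral_mul _ hd hf,
    lintegral_prod _ hfT.aemeasurable, lintegral_prod _ hfd.aemeasurable]
  refine lintegral_congr fun z => ?_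
  have hfTz : Measurable fun r : B × E => f (z, u z r.1 + r.2, r.1) :=
    hfT.comp measurable_prodMk_left
  have hfdz : Measurable fun r : E × B =>
      ((fun p : C × E × B => ℓ (u p.1 p.2.2) p.2.1) * f) (z, r) :=
    hfd.comp measurable_prodMk_left
  -- The input is made the outer variable on both sides; for fixed input the claim is the shift
  -- formula `hshift`.
  rw [lintegral_prod _ hfTz.aemeasurable, lintegral_prod_symm _ hfdz.aemeasurable]
  refine lintegral_congr fun y => ?_
  have hfy : Measurable fun x : E => f (z, x, y) := by fun_prop
  have hly : Measurable (ℓ (u z y)) := hℓ.comp measurable_prodMk_left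
  have h := lintegral_map (μ := μ.map W) hfy (g := fun x => u z y + x) (by fun_prop)
  rw [hshift, lintegral_withDensity_eq_lintegral_mul _ hly hfy] at h
  exact h.symm

end Channel

/-! ### Second moments -/

theorem integral_mul_mul_of_map_eq_prod {Ω A B C : Type*} [MeasurableSpace Ω]
    [MeasurableSpace A] [MeasurableSpace B] [MeasurableSpace C] {μ : Measure Ω}
    {X : Ω → A} {Y : Ω → B} {Z : Ω → C} (hX : Measurable X) (hY : Measurable Y)
    (hZ : Measurable Z) {μX : Measure A} {μY : Measure B} {μZ : Measure C}
    [IsProbabilityMeasure μX] [IsProbabilityMeasure μY] [IsProbabilityMeasure μZ]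
    (hlaw : μ.map (fun ω => (X ω, Y ω, Z ω)) = μX.prod (μY.prod μZ))
    {a : A → ℂ} {b : B → ℂ} {c : C → ℂ} (ha : Integrable a μX) (hb : Integrable b μY)
    (hc : Integrable c μZ) :
    Integrable (fun ω => a (X ω) * (b (Y ω) * c (Z ω))) μ ∧
      ∫ ω, a (X ω) * (b (Y ω) * c (Z ω)) ∂μ
        = (∫ x, a x ∂μX) * ((∫ y, b y ∂μY) * ∫ z, c z ∂μZ) := by
  have hT : Measurable fun ω => (X ω, Y ω, Z ω) := by fun_prop
  have hint : Integrable (fun p : A × B × C => a p.1 * (b p.2.1 * c p.2.2))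
      (μX.prod (μY.prod μZ)) := ha.mul_prod (hb.mul_prod hc)
  rw [← hlaw] at hint
  refine ⟨(integrable_map_measure hint.aestronglyMeasurable hT.aemeasurable).1 hint, ?_⟩
  have := integral_map hT.aemeasurable hint.aestronglyMeasurable
  rw [← this, hlaw, integral_prod_mul a (fun p : B × C => b p.1 * c p.2), integral_prod_mul]

theorem memLp_complexGaussianVec (L : ℕ) (v : ℝ≥0) (l : Fin L) :
    MemLp (fun z : Fin L → ℂ => z l) 2 (complexGaussianVec L v) :=
  (memLp_complexGaussian v).comp_measurePreserving
    (measurePreserving_eval (fun _ : Fin L => complexGaussian v) l)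

theorem integral_complexGaussianVec (L : ℕ) (v : ℝ≥0) (l : Fin L) :
    ∫ z, z l ∂complexGaussianVec L v = 0 := by
  have h := measurePreserving_eval (fun _ : Fin L => complexGaussian v) l
  rw [← integral_complexGaussian v, ← h.map_eq, integral_map h.measurable.aemeasurable
    (by fun_prop)]
  rfl

theorem memLp_star {α : Type*} [MeasurableSpace α] {μ : Measure α} {f : α → ℂ} {p : ℝ≥0∞}
    (hf : MemLp f p μ) : MemLp (fun x => star (f x)) p μ := hf.star

theorem integral_mul_star_complexGaussianVec (L : ℕ) (v : ℝ≥0) (l k : Fin L) :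
    ∫ z, z l * star (z k) ∂complexGaussianVec L v = if l = k then (v : ℂ) else 0 := by
  split_ifs with h
  · subst h
    have h := measurePreserving_eval (fun _ : Fin L => complexGaussian v) l
    have hc : ∫ z : ℂ, z * star z ∂complexGaussian v = v := by
      have : ∀ z : ℂ, z * star z = ((‖z‖ ^ 2 : ℝ) : ℂ) := fun z => by
        rw [Complex.star_def, Complex.mul_conj, Complex.normSq_eq_norm_sq]
      simp only [this]
      rw [integral_complex_ofReal, integral_norm_sq_complexGaussian]
    rw [← hc, ← h.map_eq, integral_map h.measurable.aemeasurable (by fun_prop)]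
    rfl
  · have hind := (iIndepFun_pi (μ := fun _ : Fin L => complexGaussian v) (X := fun _ z => z)
      (fun _ => by fun_prop)).indepFun h
    have hind' : IndepFun (fun z : Fin L → ℂ => z l) (fun z => star (z k))
        (complexGaussianVec L v) :=
      hind.comp (φ := fun z => z) (ψ := fun z => star z) measurable_id (by fun_prop)
    rw [hind'.integral_fun_mul_eq_mul_integral
      (memLp_complexGaussianVec L v l).aestronglyMeasurable
      (memLp_star (memLp_complexGaussianVec L v k)).aestronglyMeasurable,
      integral_complexGaussianVec, zero_mul]

section Moments

variable {Ω : Type*} [MeasurableSpace Ω] {μ : Measure Ω} [IsProbabilityMeasure μ] {L : ℕ}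
  {β : Ω → ℂ} {Z W : Ω → Fin L → ℂ} {α v : ℝ≥0} {T : ℝ}

/-- Constant energy bounds every coordinate, so the signal needs no separate moment assumption. -/
theorem memLp_of_sum_sq_eq {ν : Measure (Fin L → ℂ)} [IsProbabilityMeasure ν]
    (hT : ∀ᵐ z ∂ν, ∑ l, ‖z l‖ ^ 2 = T) (l : Fin L) :
    MemLp (fun z : Fin L → ℂ => z l) 2 ν := by
  refine MemLp.of_bound (measurable_pi_apply l).aestronglyMeasurable (1 + T) ?_
  filter_upwards [hT] with z hz
  have h1 : ‖z l‖ ^ 2 ≤ T := hz ▸ Finset.single_le_sum (f := fun l => ‖z l‖ ^ 2)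
    (fun _ _ => by positivity) (Finset.mem_univ l)
  nlinarith [sq_nonneg (‖z l‖ - 1)]

theorem integral_norm_sq_of_map_eq {μ : Measure Ω} (hβ_meas : Measurable β)
    (hβ : μ.map β = complexGaussian α) :
    Integrable (fun ω => ‖β ω‖ ^ 2) μ ∧ ∫ ω, ‖β ω‖ ^ 2 ∂μ = α := by
  have hint : Integrable (fun z : ℂ => ‖z‖ ^ 2) (μ.map β) :=
    hβ ▸ (memLp_complexGaussian α).norm.integrable_sq
  refine ⟨(integrable_map_measure hint.aestronglyMeasurable hβ_meas.aemeasurable).1 hint, ?_⟩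
  rw [← integral_norm_sq_complexGaussian α, ← hβ, integral_map hβ_meas.aemeasurable
    hint.aestronglyMeasurable]

/-- Each coordinate contributes a product of independent factors, one of which is centred noise. -/
theorem integral_star_mul_dotProduct (hβ_meas : Measurable β) (hZ_meas : Measurable Z)
    (hW_meas : Measurable W)
    (hlaw : μ.map (fun ω => (Z ω, β ω, W ω))
      = (μ.map Z).prod ((complexGaussian α).prod (complexGaussianVec L v)))
    (hT : ∀ᵐ z ∂(μ.map Z), ∑ l, ‖z l‖ ^ 2 = T) :
    Integrable (fun ω => star (β ω) * (star (Z ω) ⬝ᵥ W ω)) μ ∧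
      ∫ ω, star (β ω) * (star (Z ω) ⬝ᵥ W ω) ∂μ = 0 := by
  have : IsProbabilityMeasure (μ.map Z) :=
    Measure.isProbabilityMeasure_map hZ_meas.aemeasurable
  have key := fun l : Fin L => integral_mul_mul_of_map_eq_prod hZ_meas hβ_meas hW_meas hlaw
    (a := fun z => star (z l)) (b := fun b => star b) (c := fun w => w l)
    ((memLp_star (memLp_of_sum_sq_eq hT l)).integrable one_le_two)
    ((memLp_star (memLp_complexGaussian α)).integrable one_le_two)
    ((memLp_complexGaussianVec L v l).integrable one_le_two)
  have heq : ∀ ω, star (β ω) * (star (Z ω) ⬝ᵥ W ω)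
      = ∑ l, star (Z ω l) * (star (β ω) * W ω l) := fun ω => by
    simp only [dotProduct, Finset.mul_sum, Pi.star_apply]
    exact Finset.sum_congr rfl fun l _ => by ring
  simp only [heq]
  refine ⟨integrable_finsetSum _ fun l _ => (key l).1, ?_⟩
  rw [integral_finsetSum _ fun l _ => (key l).1]
  refine Finset.sum_eq_zero fun l _ => ?_
  rw [(key l).2, integral_complexGaussianVec, mul_zero, mul_zero]

/-- White noise kills the off-diagonal terms of the expanded square; the diagonal sums to the energy
times `v`. -/
theorem integral_norm_sq_dotProduct (hβ_meas : Measurable β) (hZ_meas : Measurable Z)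
    (hW_meas : Measurable W)
    (hlaw : μ.map (fun ω => (Z ω, β ω, W ω))
      = (μ.map Z).prod ((complexGaussian α).prod (complexGaussianVec L v)))
    (hT : ∀ᵐ z ∂(μ.map Z), ∑ l, ‖z l‖ ^ 2 = T) :
    Integrable (fun ω => ‖star (Z ω) ⬝ᵥ W ω‖ ^ 2) μ ∧
      ∫ ω, ‖star (Z ω) ⬝ᵥ W ω‖ ^ 2 ∂μ = T * v := by
  have : IsProbabilityMeasure (μ.map Z) :=
    Measure.isProbabilityMeasure_map hZ_meas.aemeasurable
  have hZ2 : ∀ l k : Fin L, Integrable (fun z : Fin L → ℂ => star (z l) * z k) (μ.map Z) :=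
    fun l k => (memLp_star (memLp_of_sum_sq_eq hT l)).integrable_mul (memLp_of_sum_sq_eq hT k)
  have key := fun l k : Fin L => integral_mul_mul_of_map_eq_prod hZ_meas hβ_meas hW_meas hlaw
    (a := fun z => star (z l) * z k) (b := fun _ => 1) (c := fun w => w l * star (w k))
    (hZ2 l k) (integrable_const 1)
    ((memLp_complexGaussianVec L v l).integrable_mul (memLp_star (memLp_complexGaussianVec L v k)))
  have heq : ∀ ω, ((‖star (Z ω) ⬝ᵥ W ω‖ ^ 2 : ℝ) : ℂ)
      = ∑ l, ∑ k, star (Z ω l) * Z ω k * (1 * (W ω l * star (W ω k))) := fun ω => by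
    rw [← Complex.normSq_eq_norm_sq, ← Complex.mul_conj, dotProduct, map_sum,
      Finset.sum_mul_sum]
    refine Finset.sum_congr rfl fun l _ => Finset.sum_congr rfl fun k _ => ?_
    simp only [Pi.star_apply, Complex.star_def, map_mul, Complex.conj_conj]
    ring
  have hint : Integrable (fun ω => ((‖star (Z ω) ⬝ᵥ W ω‖ ^ 2 : ℝ) : ℂ)) μ := by
    simp only [heq]
    exact integrable_finsetSum _ fun l _ => integrable_finsetSum _ fun k _ => (key l k).1
  have hval : ∫ ω, ((‖star (Z ω) ⬝ᵥ W ω‖ ^ 2 : ℝ) : ℂ) ∂μ = ((T * v : ℝ) : ℂ) := by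
    simp only [heq]
    rw [integral_finsetSum _ fun l _ => integrable_finsetSum _ fun k _ => (key l k).1]
    have hl : ∀ l : Fin L, ∫ ω, ∑ k, star (Z ω l) * Z ω k * (1 * (W ω l * star (W ω k))) ∂μ
        = (∫ z, star (z l) * z l ∂(μ.map Z)) * v := fun l => by
      rw [integral_finsetSum _ fun k _ => (key l k).1]
      simp only [(key l _).2, integral_mul_star_complexGaussianVec]
      simp
    simp only [hl]
    rw [← Finset.sum_mul, ← integral_finsetSum _ fun l _ => hZ2 l l]
    have hae : (fun z : Fin L → ℂ => ∑ l, star (z l) * z l) =ᵐ[μ.map Z] fun _ => (T : ℂ) := by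
      filter_upwards [hT] with z hz
      rw [← hz, Complex.ofReal_sum]
      refine Finset.sum_congr rfl fun l _ => ?_
      rw [Complex.star_def, mul_comm, Complex.mul_conj, Complex.normSq_eq_norm_sq]
    rw [integral_congr_ae hae]
    simp
  refine ⟨(integrable_congr (Filter.Eventually.of_forall fun ω => Complex.ofReal_re _)).1 hint.re, ?_⟩
  rw [integral_complex_ofReal] at hval
  exact_mod_cast hval

end Moments

/-! ### Mutual information of the Gaussian channel -/

theorem sum_norm_sq_smul {L : ℕ} (a : ℂ) (z : Fin L → ℂ) :
    ∑ l, ‖(a • z) l‖ ^ 2 = ‖a‖ ^ 2 * ∑ l, ‖z l‖ ^ 2 := by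
  simp only [Pi.smul_apply, smul_eq_mul, norm_mul, mul_pow, Finset.mul_sum]

theorem star_dotProduct_self {L : ℕ} (z : Fin L → ℂ) :
    star z ⬝ᵥ z = ((∑ l, ‖z l‖ ^ 2 : ℝ) : ℂ) := by
  rw [dotProduct, Complex.ofReal_sum]
  refine Finset.sum_congr rfl fun l _ => ?_
  rw [Pi.star_apply, Complex.star_def, mul_comm, Complex.mul_conj, Complex.normSq_eq_norm_sq]

/-- The log-likelihood ratio of the Gaussian channel, in terms of the input `b` and of the
correlation `ξ` between signal and noise. -/
theorem gaussian_llr_eq {α v T : ℝ} (hα : 0 < α) (hv : 0 < v) (hT : 0 ≤ T) (a b ξ : ℂ) :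
    2 * (star b * (star a * (a * b * T + ξ) / v)).re - ‖a‖ ^ 2 * T / v * ‖b‖ ^ 2
      - (-Real.log (1 + ‖a‖ ^ 2 * T / v * α)
        + α * ‖star a * (a * b * T + ξ) / v‖ ^ 2 / (1 + ‖a‖ ^ 2 * T / v * α))
      = Real.log (1 + ‖a‖ ^ 2 * T / v * α)
        + (‖a‖ ^ 2 * T / v / (1 + ‖a‖ ^ 2 * T / v * α) * ‖b‖ ^ 2
          + (2 / (v * (1 + ‖a‖ ^ 2 * T / v * α)) * (star a * (star b * ξ)).re
            - α * ‖a‖ ^ 2 / v ^ 2 / (1 + ‖a‖ ^ 2 * T / v * α) * ‖ξ‖ ^ 2)) := by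
  have h1 : (star b * (star a * (a * b * T + ξ) / v)).re
      = (‖a‖ ^ 2 * T * ‖b‖ ^ 2 + (star a * (star b * ξ)).re) / v := by
    rw [← mul_div_assoc, Complex.div_ofReal_re]
    congr 1
    simp only [← Complex.normSq_eq_norm_sq, Complex.normSq_apply, Complex.add_re, Complex.add_im,
      Complex.mul_re, Complex.mul_im, Complex.star_def, Complex.conj_re, Complex.conj_im,
      Complex.ofReal_re, Complex.ofReal_im]
    ring
  have h2 : ‖star a * (a * b * T + ξ) / v‖ ^ 2
      = ‖a‖ ^ 2 / v ^ 2 * (‖a‖ ^ 2 * ‖b‖ ^ 2 * T ^ 2 + 2 * T * (star a * (star b * ξ)).re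
        + ‖ξ‖ ^ 2) := by
    rw [norm_div, norm_mul, norm_star, Complex.norm_real, Real.norm_of_nonneg hv.le, div_pow,
      mul_pow, mul_div_right_comm]
    congr 1
    simp only [← Complex.normSq_eq_norm_sq, Complex.normSq_apply, Complex.add_re, Complex.add_im,
      Complex.mul_re, Complex.mul_im, Complex.star_def, Complex.conj_re, Complex.conj_im,
      Complex.ofReal_re, Complex.ofReal_im]
    ring
  rw [h1, h2]
  have hD : 0 < 1 + ‖a‖ ^ 2 * T / v * α := by positivity
  have hD' : 0 < v + ‖a‖ ^ 2 * T * α := by positivity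
  have hDeq : 1 + ‖a‖ ^ 2 * T / v * α = (v + ‖a‖ ^ 2 * T * α) / v := by field_simp
  rw [hDeq]
  field_simp
  ring

theorem integral_affine_combination {Ω : Type*} [MeasurableSpace Ω] {μ : Measure Ω}
    [IsProbabilityMeasure μ] {f g h : Ω → ℝ} (hf : Integrable f μ) (hg : Integrable g μ)
    (hh : Integrable h μ) (c₀ c₁ c₂ c₃ : ℝ) :
    Integrable (fun ω => c₀ + (c₁ * f ω + (c₂ * g ω - c₃ * h ω))) μ ∧
      ∫ ω, c₀ + (c₁ * f ω + (c₂ * g ω - c₃ * h ω)) ∂μ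
        = c₀ + (c₁ * ∫ ω, f ω ∂μ + (c₂ * ∫ ω, g ω ∂μ - c₃ * ∫ ω, h ω ∂μ)) := by
  have h1 := hf.const_mul c₁
  have h2 := hg.const_mul c₂
  have h3 := hh.const_mul c₃
  have h23 : Integrable (fun ω => c₂ * g ω - c₃ * h ω) μ := h2.sub h3
  have h123 : Integrable (fun ω => c₁ * f ω + (c₂ * g ω - c₃ * h ω)) μ := h1.add h23
  refine ⟨(integrable_const c₀).add h123, ?_⟩
  rw [integral_add (integrable_const c₀) h123, integral_add h1 h23, integral_sub h2 h3,
    integral_const_mul, integral_const_mul, integral_const_mul]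
  simp

/-- Mutual information of the channel `X = a β Z + W` with Gaussian input `β` and white Gaussian
noise `W`, given a side information `Z` of constant energy `T`. The input may be observed through
a map `f` from which `a β` can be recovered. -/
theorem condMutualInfo_gaussian {Ω B : Type*} [MeasurableSpace Ω] [MeasurableSpace B]
    [StandardBorelSpace B] [Nonempty B] {μ : Measure Ω} [IsProbabilityMeasure μ] {L : ℕ}
    {β : Ω → ℂ} {Z W : Ω → Fin L → ℂ} {α v : ℝ≥0} (hα : 0 < α) (hv : 0 < v) {T : ℝ} (hT0 : 0 ≤ T)
    (hβ_meas : Measurable β) (hZ_meas : Measurable Z) (hW_meas : Measurable W)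
    (hβ : μ.map β = complexGaussian α) (hW : μ.map W = complexGaussianVec L v)
    (hT : ∀ᵐ ω ∂μ, ∑ l, ‖Z ω l‖ ^ 2 = T)
    (hβW : IndepFun β W μ) (hZβW : IndepFun Z (fun ω => (β ω, W ω)) μ)
    {a : ℂ} {f : ℂ → B} {q : B → ℂ} (hf : Measurable f) (hq : Measurable q)
    (hqf : ∀ b, q (f b) = a * b) :
    condMutualInfo μ (fun ω => (a * β ω) • Z ω + W ω) (fun ω => f (β ω)) Z
      = ENNReal.ofReal (Real.log (1 + ‖a‖ ^ 2 * T / v * α)) / ENNReal.ofReal (Real.log 2) := by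
  have hv0 : (0 : ℝ) < v := hv
  have hα0 : (0 : ℝ) < α := hα
  have hY_meas : Measurable fun ω => f (β ω) := hf.comp hβ_meas
  have hlaw : μ.map (fun ω => (Z ω, β ω, W ω))
      = (μ.map Z).prod ((complexGaussian α).prod (complexGaussianVec L v)) := by
    rw [(indepFun_iff_map_prod_eq_prod_map_map hZ_meas.aemeasurable
      (hβ_meas.prodMk hW_meas).aemeasurable).1 hZβW,
      (indepFun_iff_map_prod_eq_prod_map_map hβ_meas.aemeasurable hW_meas.aemeasurable).1 hβW,
      hβ, hW]
  have hZYW : IndepFun Z (fun ω => (f (β ω), W ω)) μ :=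
    hZβW.comp (φ := id) (ψ := fun p : ℂ × (Fin L → ℂ) => (f p.1, p.2)) measurable_id (by fun_prop)
  have hYW : IndepFun (fun ω => f (β ω)) W μ := hβW.comp hf measurable_id
  have hlawY : μ.map (fun ω => (Z ω, f (β ω), W ω))
      = (μ.map Z).prod ((μ.map fun ω => f (β ω)).prod (μ.map W)) := by
    rw [(indepFun_iff_map_prod_eq_prod_map_map hZ_meas.aemeasurable
      (hY_meas.prodMk hW_meas).aemeasurable).1 hZYW,
      (indepFun_iff_map_prod_eq_prod_map_map hY_meas.aemeasurable hW_meas.aemeasurable).1 hYW]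
  have hZY : IndepFun Z (fun ω => f (β ω)) μ :=
    hZYW.comp (φ := id) (ψ := Prod.fst) measurable_id measurable_fst
  have hTZ : ∀ᵐ z ∂(μ.map Z), ∑ l, ‖z l‖ ^ 2 = T := by
    rw [ae_map_iff hZ_meas.aemeasurable (measurableSet_eq_fun (by fun_prop) (by fun_prop))]
    exact hT
  obtain ⟨hi1, hv1⟩ := integral_norm_sq_of_map_eq hβ_meas hβ
  obtain ⟨hi2, hv2⟩ := integral_star_mul_dotProduct hβ_meas hZ_meas hW_meas hlaw hTZ
  obtain ⟨hi3, hv3⟩ := integral_norm_sq_dotProduct hβ_meas hZ_meas hW_meas hlaw hTZ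
  have hdot : Measurable fun p : (Fin L → ℂ) × (Fin L → ℂ) => star p.1 ⬝ᵥ p.2 := by
    simp only [dotProduct, Pi.star_apply]; fun_prop
  let F : (Fin L → ℂ) × (Fin L → ℂ) × B → ℝ := fun p =>
    (2 * (star (q p.2.2 • p.1) ⬝ᵥ p.2.1).re - ∑ l, ‖(q p.2.2 • p.1) l‖ ^ 2) / v
  let ζ : (Fin L → ℂ) × (Fin L → ℂ) → ℂ := fun p => star a * (star p.1 ⬝ᵥ p.2) / (v : ℝ)
  -- The actual energy of `z` is used instead of `T`, because `hFG` is needed for every `z` and the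
  -- energy equals `T` only almost surely.
  let Q : (Fin L → ℂ) → ℝ := fun z => ‖a‖ ^ 2 * (∑ l, ‖z l‖ ^ 2) / v
  let G : (Fin L → ℂ) × (Fin L → ℂ) → ℝ := fun p =>
    -Real.log (1 + Q p.1 * α) + α * ‖ζ p‖ ^ 2 / (1 + Q p.1 * α)
  have hℓ : Measurable fun p : (Fin L → ℂ) × (Fin L → ℂ) =>
      (2 * (star p.1 ⬝ᵥ p.2).re - ∑ l, ‖p.1 l‖ ^ 2) / (v : ℝ) := by fun_prop
  have hF : Measurable F :=
    hℓ.comp (f := fun p : (Fin L → ℂ) × (Fin L → ℂ) × B => (q p.2.2 • p.1, p.2.1)) (by fun_prop)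
  have hG : Measurable G := by
    simp only [G, Q, ζ]; fun_prop
  have hFeq : ∀ z x b, F (z, x, f b) = 2 * (star b * ζ (z, x)).re - Q z * ‖b‖ ^ 2 := by
    intro z x b
    simp only [F, ζ, Q, hqf, sum_norm_sq_smul, star_smul, smul_dotProduct, smul_eq_mul, star_mul',
      norm_mul]
    rw [← mul_div_assoc (star b), Complex.div_ofReal_re,
      show star a * star b * (star z ⬝ᵥ x) = star b * (star a * (star z ⬝ᵥ x)) by ring]
    ring
  have hFG : ∀ z x, ∫⁻ y, ENNReal.ofReal (Real.exp (F (z, x, y))) ∂(μ.map fun ω => f (β ω))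
      = ENNReal.ofReal (Real.exp (G (z, x))) := by
    intro z x
    have hQ : 0 ≤ Q z := by simp only [Q]; positivity
    have hQ' : 0 < 1 + Q z * α := by positivity
    have hm : μ.map (fun ω => f (β ω)) = (complexGaussian α).map f := by
      rw [← hβ, Measure.map_map hf hβ_meas]; rfl
    rw [hm, lintegral_map (by fun_prop) hf]
    simp only [hFeq]
    rw [lintegral_exp_complexGaussian hα.ne' hQ]
    simp only [G]
    rw [Real.exp_add, Real.exp_neg, Real.exp_log hQ']
  have hjoint := map_additive_channel hY_meas hZ_meas hW_meas hlawY (u := fun z y => q y • z)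
    (by fun_prop) (ℓ := fun u x =>
      ENNReal.ofReal (Real.exp ((2 * (star u ⬝ᵥ x).re - ∑ l, ‖u l‖ ^ 2) / v))) (by fun_prop)
    (fun u => by rw [hW]; exact complexGaussianVec_map_add hv.ne' u)
  simp only [hqf] at hjoint
  -- On the event of energy `T`, inserting `X = a β Z + W` gives `Z* X = a β T + Z* W`.
  have hae : (fun ω => F (Z ω, (a * β ω) • Z ω + W ω, f (β ω)) - G (Z ω, (a * β ω) • Z ω + W ω))
      =ᵐ[μ] fun ω => Real.log (1 + ‖a‖ ^ 2 * T / v * α)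
        + (‖a‖ ^ 2 * T / v / (1 + ‖a‖ ^ 2 * T / v * α) * ‖β ω‖ ^ 2
          + (2 / (v * (1 + ‖a‖ ^ 2 * T / v * α))
              * (star a * (star (β ω) * (star (Z ω) ⬝ᵥ W ω))).re
            - α * ‖a‖ ^ 2 / v ^ 2 / (1 + ‖a‖ ^ 2 * T / v * α) * ‖star (Z ω) ⬝ᵥ W ω‖ ^ 2)) := by
    filter_upwards [hT] with ω hω
    rw [hFeq, ← gaussian_llr_eq hα0 hv0 hT0]
    simp only [G, Q, ζ, dotProduct_add, dotProduct_smul, star_dotProduct_self, hω, smul_eq_mul]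
  have hi2' := hi2.const_mul (star a)
  have hv2' : ∫ ω, (star a * (star (β ω) * (star (Z ω) ⬝ᵥ W ω))).re ∂μ = 0 := by
    have h := Complex.reCLM.integral_comp_comm hi2'
    rw [integral_const_mul, hv2] at h
    simpa using! h
  have hi2r : Integrable (fun ω => (star a * (star (β ω) * (star (Z ω) ⬝ᵥ W ω))).re) μ := hi2'.re
  obtain ⟨hI, hval⟩ := integral_affine_combination hi1 hi2r hi3
    (Real.log (1 + ‖a‖ ^ 2 * T / v * α)) (‖a‖ ^ 2 * T / v / (1 + ‖a‖ ^ 2 * T / v * α))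
    (2 / (v * (1 + ‖a‖ ^ 2 * T / v * α))) (α * ‖a‖ ^ 2 / v ^ 2 / (1 + ‖a‖ ^ 2 * T / v * α))
  have : IsProbabilityMeasure (μ.map W) :=
    Measure.isProbabilityMeasure_map hW_meas.aemeasurable
  rw [condMutualInfo_of_density (by fun_prop) hY_meas hZ_meas hF hjoint hZY hG hFG
    ((integrable_congr hae).2 hI), integral_congr_ae hae, hval, hv1, hv2', hv3]
  -- The means of `‖β‖²` and `‖Z* W‖²` are `α` and `T v`; with their coefficients both terms equal
  -- `γ / (1 + γ)` and cancel.
  congr 2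
  field_simp
  ring

/-! ### Reduction of the sensing model to the Gaussian channel -/

theorem norm_exp_neg_I_mul (x : ℝ) : ‖Complex.exp (-Complex.I * (x : ℂ))‖ = 1 := by
  rw [Complex.norm_exp]; simp

end PASS

theorem lemma1 {Ω : Type*} [MeasurableSpace Ω] (μ : Measure Ω) [IsProbabilityMeasure μ]
    (N L : ℕ) (hN : 0 < N) (hL : 0 < L) (S : PASS.Params N)
    (P : ℝ) (hP : 0 < P) (αs σ2 : ℝ≥0) (hα : 0 < αs) (hσ : 0 < σ2)
    (β : Ω → ℂ) (s n : Ω → Fin L → ℂ)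
    (hβ_meas : Measurable β) (hs_meas : Measurable s) (hn_meas : Measurable n)
    (hβ : μ.map β = PASS.complexGaussian αs)
    (hn : μ.map n = PASS.complexGaussianVec L σ2)
    (hs : ∀ᵐ ω ∂μ, (L : ℝ)⁻¹ * ∑ l, ‖s ω l‖ ^ 2 = 1)
    (hβn : IndepFun β n μ)
    (hsβn : IndepFun s (fun ω => (β ω, n ω)) μ) :
    S.sensingRate μ P β s n =
      ENNReal.ofReal ((L : ℝ)⁻¹ * Real.logb 2 (1 + S.gammaS L P αs σ2)) := by
  have hphi : ‖S.phiR‖ = 1 := PASS.norm_exp_neg_I_mul _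
  have hN0 : (0 : ℝ) < N := by exact_mod_cast hN
  have hL0 : (0 : ℝ) < L := by exact_mod_cast hL
  have hσ0 : (0 : ℝ) < σ2 := hσ
  -- `k` is the deterministic factor in front of `gᵀ φ_t`, so that `k (gᵀ φ_t) = a β`.
  set k : ℂ := S.phiR * (Real.sqrt (1 / (N : ℝ)) : ℂ) with hk
  set a : ℂ := k * (S.gr * (S.hVec ⬝ᵥ S.phiT)) with ha
  have hX : (fun ω => S.phiR • S.echo (S.targetResponse (β ω)) (PASS.Params.txSignal P (s ω)) (n ω))
      = fun ω => (a * β ω) • PASS.Params.txSignal P (s ω) + S.phiR • n ω := by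
    funext ω
    simp only [PASS.Params.echo, PASS.Params.targetResponse, smul_add, smul_smul, smul_dotProduct,
      smul_eq_mul, ha, hk]
    congr 2
    ring
  have hx : Measurable fun z : Fin L → ℂ => PASS.Params.txSignal P z := by
    unfold PASS.Params.txSignal; fun_prop
  have hφ : Measurable fun z : Fin L → ℂ => S.phiR • z := by fun_prop
  have hT : ∀ᵐ ω ∂μ, ∑ l, ‖PASS.Params.txSignal P (s ω) l‖ ^ 2 = P * L := by
    filter_upwards [hs] with ω hω
    rw [PASS.Params.txSignal, PASS.sum_norm_sq_smul, Complex.norm_real, Real.norm_eq_abs, sq_abs,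
      Real.sq_sqrt hP.le]
    field_simp at hω
    rw [hω]
  have hW : μ.map (fun ω => S.phiR • n ω) = PASS.complexGaussianVec L σ2 := by
    rw [← PASS.complexGaussianVec_map_smul hσ.ne' hphi, ← hn, Measure.map_map hφ hn_meas]
    rfl
  -- The map `q` recovers `a β` from `g` without division, so the degenerate case `hᵀ φ_t = 0` needs
  -- no separate treatment.
  have hI := PASS.condMutualInfo_gaussian (a := a) (f := S.targetResponse)
    (q := fun y => k * (y ⬝ᵥ S.phiT)) hα hσ (by positivity) hβ_meas (hx.comp hs_meas)
    (hφ.comp hn_meas) hβ hW hT (hβn.comp measurable_id hφ)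
    (hsβn.comp hx (ψ := fun p : ℂ × (Fin L → ℂ) => (p.1, S.phiR • p.2)) (by fun_prop))
    (by unfold PASS.Params.targetResponse; fun_prop) (by simp only [dotProduct]; fun_prop)
    (fun b => by
      simp only [PASS.Params.targetResponse, smul_dotProduct, smul_eq_mul, ha]; ring)
  have hγ : ‖a‖ ^ 2 * (P * L) / σ2 * αs = S.gammaS L P αs σ2 := by
    have hsq : Real.sqrt (1 / (N : ℝ)) ^ 2 = 1 / N := Real.sq_sqrt (by positivity)
    simp only [ha, hk, norm_mul, hphi, Complex.norm_real, Real.norm_eq_abs, mul_pow, sq_abs, hsq,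
      PASS.Params.gammaS]
    ring
  unfold PASS.Params.sensingRate
  rw [hX]
  refine (congrArg _ hI).trans ?_
  rw [hγ, ← ENNReal.ofReal_div_of_pos (Real.log_pos one_lt_two), ENNReal.ofReal_mul (by positivity),
    ENNReal.ofReal_inv_of_pos hL0, ENNReal.ofReal_natCast]
  rfl
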